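/- Define $\psi:\mathbb Z^2\to\mathbb C$ by $\psi=\frac{1}{960000}(\psi_1+\psi_2+\psi_3)$, where $\psi_1,\psi_2,\psi_3$ vanish except for the values $$\psi_1(0,0)=862318,\quad \psi_1(\pm1,0)=22500\pm19200i,\quad \psi_1(\pm2,0)=-3412,\quad \psi_1(\pm3,0)=1500,\quad \psi_1(\pm4,0)=-797,$$ $$\psi_2(0,\pm1)=38400,\quad \psi_2(0,\pm2)=-9225,\quad \psi_2(0,\pm4)=-150,\quad \psi_2(0,\pm6)=25,$$ $$\psi_3(-1,1)=\psi_3(-1,-1)=9600i,\quad \psi_3(1,1)=\psi_3(1,-1)=-9600i.$$ Let $\widehat\psi(\xi)=\sum_{x\in\mathbb Z^2}\psi(x)e^{ix\cdot\xi}$ for $\xi=(\eta,\zeta)\in\mathbb R^2$, let $P(\xi)=(\eta+\zeta^2)^2+\eta^4$, and define $R$ by $\log\widehat\psi(\xi)=-\frac{1}{100}P(\xi)+R(\xi)$ (principal logarithm; $\widehat\psi(0)=1$). Let $\psi^{(1)}=\psi$, let $\psi^{(n)}(x)=\sum_{y\in\mathbb Z^2}\psi^{(n-1)}(x-y)\psi(y)$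 for $n\ge2$, and let $\|f\|_\infty=\sup_{x\in\mathbb Z^2}|f(x)|$. Then $R(\xi)=O(|\xi|^5)$ as $\xi\to0$, while $R(\xi)$ is not $o(P(\xi))$ as $\xi\to0$, and $$\lim_{n\to\infty}n^{5/8}\|\psi^{(n)}\|_\infty=0.$$ In particular, $\|\psi^{(n)}\|_\infty$ is not bounded below by any positive constant multiple of $n^{-5/8}$. -/

import Mathlib

open Filter Topology Asymptotics

noncomputable section

/-- Convolution of complex-valued functions on `ℤ²`:
`(f * g)(x) = ∑_{y ∈ ℤ²} f (x - y) g y`. -/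
def convolution2 (f g : ℤ × ℤ → ℂ) : ℤ × ℤ → ℂ :=
  fun x => ∑' y : ℤ × ℤ, f (x - y) * g y

/-- Iterated convolution powers: `f^(1) = f` and `f^(n) = f^(n-1) * f` for `n ≥ 2`
(by convention, the zeroth power is the unit mass at the origin). -/
def convPow (f : ℤ × ℤ → ℂ) : ℕ → ℤ × ℤ → ℂ
  | 0 => Pi.single 0 1
  | 1 => f
  | n + 2 => convolution2 (convPow f (n + 1)) f

/-- The supremum norm of a (bounded) function on `ℤ²`. -/
def supNorm (f : ℤ × ℤ → ℂ) : ℝ := ⨆ x : ℤ × ℤ, ‖f x‖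

/-- The Fourier transform `f̂(ξ) = ∑_{x ∈ ℤ²} f(x) e^{i x·ξ}` of a (finitely supported)
function on `ℤ²`. -/
def fourierHat (f : ℤ × ℤ → ℂ) (ξ : ℝ × ℝ) : ℂ :=
  ∑' x : ℤ × ℤ, f x * Complex.exp (Complex.I * ((x.1 * ξ.1 + x.2 * ξ.2 : ℝ) : ℂ))

/-- The symbol `P(η, ζ) = (η + ζ²)² + η⁴`. -/
def symbolP (ξ : ℝ × ℝ) : ℝ := (ξ.1 + ξ.2 ^ 2) ^ 2 + ξ.1 ^ 4

def psi₁ (x : ℤ × ℤ) : ℂ :=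
  if x = (0, 0) then 862318
  else if x = (1, 0) then 22500 + 19200 * Complex.I
  else if x = (-1, 0) then 22500 - 19200 * Complex.I
  else if x = (2, 0) ∨ x = (-2, 0) then -3412
  else if x = (3, 0) ∨ x = (-3, 0) then 1500
  else if x = (4, 0) ∨ x = (-4, 0) then -797
  else 0

def psi₂ (x : ℤ × ℤ) : ℂ :=
  if x = (0, 1) ∨ x = (0, -1) then 38400
  else if x = (0, 2) ∨ x = (0, -2) then -9225
  else if x = (0, 4) ∨ x = (0, -4) then -150
  else if x = (0, 6) ∨ x = (0, -6) then 25
  else 0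

def psi₃ (x : ℤ × ℤ) : ℂ :=
  if x = (-1, 1) ∨ x = (-1, -1) then 9600 * Complex.I
  else if x = (1, 1) ∨ x = (1, -1) then -(9600 * Complex.I)
  else 0

/-- The function `ψ = (ψ₁ + ψ₂ + ψ₃) / 960000` on `ℤ²`. -/
def psi (x : ℤ × ℤ) : ℂ := (psi₁ x + psi₂ x + psi₃ x) / 960000

/-- The remainder `R = log ψ̂ + P/100`, so that `log ψ̂ = -P/100 + R`
(principal branch; `ψ̂` is continuous with `ψ̂(0) = 1`). -/
def remainderR (ξ : ℝ × ℝ) : ℂ :=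
  Complex.log (fourierHat psi ξ) + (symbolP ξ : ℂ) / 100

theorem psi_support_finite : (Function.support psi).Finite := by
  refine (Set.finite_Icc ((-4, -6) : ℤ × ℤ) (4, 6)).subset ?_
  rintro ⟨a, b⟩ hx
  by_contra h
  refine hx ?_
  have key : ∀ c d : ℤ, -4 ≤ c → c ≤ 4 → -6 ≤ d → d ≤ 6 → ((a, b) : ℤ × ℤ) ≠ (c, d) := by
    intro c d h1 h2 h3 h4 he
    rw [he] at h
    exact h ⟨⟨h1, h3⟩, ⟨h2, h4⟩⟩
  simp [psi, psi₁, psi₂, psi₃, -Prod.mk.injEq, key]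

/-- The convolution powers of a finitely supported function are bounded, so their supremum
norms are genuine suprema. -/
theorem convPow_bddAbove {f : ℤ × ℤ → ℂ} (hf : (Function.support f).Finite) (n : ℕ) :
    BddAbove (Set.range fun x => ‖convPow f n x‖) := by
  have hs : Summable fun y => ‖f y‖ := by
    refine summable_of_hasFiniteSupport (hf.subset ?_)
    intro y hy h0
    exact hy (by simp [h0])
  have h1 : ∀ x, ‖f x‖ ≤ ∑' y, ‖f y‖ := fun x => hs.le_tsum x (fun _ _ => norm_nonneg _)
  suffices h : ∀ n, ∃ M, ∀ x, ‖convPow f n x‖ ≤ M by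
    obtain ⟨M, hM⟩ := h n
    exact ⟨M, by rintro _ ⟨x, rfl⟩; exact hM x⟩
  intro n
  induction n with
  | zero =>
    refine ⟨1, fun x => ?_⟩
    by_cases hx : x = 0
    · simp [convPow, hx]
    · simp [convPow, hx]
  | succ k ih =>
    cases k with
    | zero => exact ⟨_, h1⟩
    | succ m =>
      obtain ⟨M, hM⟩ := ih
      refine ⟨∑' y, M * ‖f y‖, fun x => ?_⟩
      refine tsum_of_norm_bounded (hs.mul_left M).hasSum fun y => ?_
      rw [norm_mul]
      exact mul_le_mul_of_nonneg_right (hM _) (norm_nonneg _)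

end

/-!
The Fourier transform of `ψ` is real, and a trigonometric identity writes it as `1 - D`, where
`25 D = (1 - cos ζ + sin η / 2)² + sin⁶ ζ / 24 + (1 - cos η)² q(1 - cos η)` and the quadratic
polynomial `q` is bounded below by `1 / 2` (`fourierHat_psi`, `symbol_quartic_lower_bound`).
All assertions follow from this sum of nonnegative terms.

* The Taylor polynomial of degree four of `log (1 - D)` at the origin is `-P / 100`
  (`remainderR_isBigO`).
* On the curve `η = -ζ²` one has `P = ζ⁸`, but `D ≥ sin⁶ ζ / 600`, so `R` is of order `ζ⁶` there
  and is not `o(P)` (`remainderR_not_isLittleO`).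
* By Fourier inversion (`convPow_eq_integral`), `‖ψ⁽ⁿ⁾‖_∞` is at most a multiple of
  `∫ (1 - D)ⁿ ≤ ∫ exp (-n D)`. Apart from an exponentially small term, this is bounded by
  `∫∫ exp (-n (1 - cos ζ + sin η / 2)² / 25) exp (-n sin⁶ ζ / 600) dη dζ`, in which the inner
  integral is `O(n ^ (-1 / 2))` uniformly in `ζ` and the outer one gives a further factor
  `O(n ^ (-1 / 6))`. The decay `n ^ (-2 / 3)` is faster than `n ^ (-5 / 8)`: the term of order
  `ζ⁶` in `R` replaces the `ζ⁸` of `P` along the degenerate curve.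
-/

/-! ### The Fourier transform in closed form -/

/-- The real function `1 - ψ̂`, written as a sum of nonnegative terms (see `fourierHat_psi`). -/
noncomputable def defect (ξ : ℝ × ℝ) : ℝ :=
  ((1 - Real.cos ξ.2 + Real.sin ξ.1 / 2) ^ 2 + Real.sin ξ.2 ^ 6 / 24 +
    (1 - Real.cos ξ.1) ^ 2 * (797 / 600 - 1219 / 1200 * (1 - Real.cos ξ.1)
      + 797 / 2400 * (1 - Real.cos ξ.1) ^ 2)) / 25

/-- The support of `ψ`, as a finite set. -/
def psiSupport : Finset (ℤ × ℤ) :=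
  {(0, 0), (1, 0), (-1, 0), (2, 0), (-2, 0), (3, 0), (-3, 0), (4, 0), (-4, 0),
    (0, 1), (0, -1), (0, 2), (0, -2), (0, 4), (0, -4), (0, 6), (0, -6),
    (-1, 1), (-1, -1), (1, 1), (1, -1)}

theorem psi_eq_zero_of_notMem {x : ℤ × ℤ} (hx : x ∉ psiSupport) : psi x = 0 := by
  simp only [psiSupport, Finset.mem_insert, Finset.mem_singleton, not_or] at hx
  simp [psi, psi₁, psi₂, psi₃, hx]

theorem fourierHat_psi_eq_sum (ξ : ℝ × ℝ) :
    fourierHat psi ξ = ∑ x ∈ psiSupport,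
      psi x * Complex.exp (Complex.I * ((x.1 * ξ.1 + x.2 * ξ.2 : ℝ) : ℂ)) :=
  tsum_eq_sum fun x hx => by rw [psi_eq_zero_of_notMem hx, zero_mul]

theorem sum_psiSupport (g : ℤ × ℤ → ℂ) :
    ∑ x ∈ psiSupport, psi x * g x = (862318 * g (0, 0)
      + (22500 + 19200 * Complex.I) * g (1, 0) + (22500 - 19200 * Complex.I) * g (-1, 0)
      - 3412 * (g (2, 0) + g (-2, 0)) + 1500 * (g (3, 0) + g (-3, 0))
      - 797 * (g (4, 0) + g (-4, 0)) + 38400 * (g (0, 1) + g (0, -1))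
      - 9225 * (g (0, 2) + g (0, -2)) - 150 * (g (0, 4) + g (0, -4))
      + 25 * (g (0, 6) + g (0, -6))
      + 9600 * Complex.I * (g (-1, 1) + g (-1, -1) - g (1, 1) - g (1, -1))) / 960000 := by
  unfold psiSupport
  repeat rw [Finset.sum_insert (by decide)]
  rw [Finset.sum_singleton]
  simp [psi, psi₁, psi₂, psi₃]
  ring

/-- The Fourier transform of `ψ` is real, and `1 - ψ̂` is the sum of nonnegative terms `defect`. -/
theorem fourierHat_psi (ξ : ℝ × ℝ) : fourierHat psi ξ = ((1 - defect ξ : ℝ) : ℂ) := by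
  obtain ⟨η, ζ⟩ := ξ
  rw [fourierHat_psi_eq_sum, sum_psiSupport]
  have he : ∀ t : ℝ, Complex.exp (Complex.I * (t : ℂ)) =
      (Real.cos t : ℂ) + (Real.sin t : ℂ) * Complex.I := fun t => by
    rw [mul_comm, Complex.exp_mul_I, Complex.ofReal_cos, Complex.ofReal_sin]
  have h4 : ∀ t : ℝ, Real.cos (4 * t) = 8 * Real.cos t ^ 4 - 8 * Real.cos t ^ 2 + 1 := fun t => by
    rw [show 4 * t = 2 * (2 * t) by ring, Real.cos_two_mul, Real.cos_two_mul]; ring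
  have h6 : ∀ t : ℝ, Real.cos (6 * t) =
      32 * Real.cos t ^ 6 - 48 * Real.cos t ^ 4 + 18 * Real.cos t ^ 2 - 1 := fun t => by
    rw [show 6 * t = 3 * (2 * t) by ring, Real.cos_three_mul, Real.cos_two_mul]; ring
  have hs1 : (Real.sin η : ℂ) ^ 2 = 1 - (Real.cos η : ℂ) ^ 2 := mod_cast Real.sin_sq η
  have hs2 : (Real.sin ζ : ℂ) ^ 2 = 1 - (Real.cos ζ : ℂ) ^ 2 := mod_cast Real.sin_sq ζ
  have hs6 : (Real.sin ζ : ℂ) ^ 6 = (1 - (Real.cos ζ : ℂ) ^ 2) ^ 3 := by rw [← hs2]; ring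
  simp only [he]
  simp [-Complex.ofReal_cos, -Complex.ofReal_sin, defect, Real.cos_add, Real.sin_add, h4, h6,
    Real.cos_two_mul, Real.cos_three_mul]
  -- the only nonreal coefficients contribute products of two factors `I`
  linear_combination (1 / 100 : ℂ) * hs1 + (1 / 600 : ℂ) * hs6 +
    (Real.sin η / 25 * (1 - Real.cos ζ) : ℂ) * Complex.I_sq

/-- The discriminant of the quadratic factor in `defect` is negative, so the factor stays away
from zero. -/
theorem symbol_quartic_lower_bound (c : ℝ) :
    1 / 2 ≤ 797 / 600 - 1219 / 1200 * c + 797 / 2400 * c ^ 2 := by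
  nlinarith [sq_nonneg (c - 1219 / 797)]

theorem sin_pow_six_le_defect (ξ : ℝ × ℝ) : Real.sin ξ.2 ^ 6 / 600 ≤ defect ξ := by
  have := symbol_quartic_lower_bound (1 - Real.cos ξ.1)
  have : 0 ≤ (1 - Real.cos ξ.1) ^ 2 * (797 / 600 - 1219 / 1200 * (1 - Real.cos ξ.1)
      + 797 / 2400 * (1 - Real.cos ξ.1) ^ 2) := mul_nonneg (sq_nonneg _) (by linarith)
  unfold defect
  nlinarith [sq_nonneg (1 - Real.cos ξ.2 + Real.sin ξ.1 / 2)]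

theorem defect_lt_one (ξ : ℝ × ℝ) : defect ξ < 1 := by
  have a1 := Real.neg_one_le_cos ξ.1
  have a2 := Real.cos_le_one ξ.1
  have b1 := Real.neg_one_le_cos ξ.2
  have b2 := Real.cos_le_one ξ.2
  have c1 := Real.neg_one_le_sin ξ.1
  have c2 := Real.sin_le_one ξ.1
  have d2 : Real.sin ξ.2 ^ 6 ≤ 1 := by
    have h : Real.sin ξ.2 ^ 2 ≤ 1 := by
      nlinarith [Real.sin_sq_add_cos_sq ξ.2, sq_nonneg (Real.cos ξ.2)]
    calc Real.sin ξ.2 ^ 6 = (Real.sin ξ.2 ^ 2) ^ 3 := by ring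
      _ ≤ 1 := pow_le_one₀ (sq_nonneg _) h
  have e1 : (1 - Real.cos ξ.2 + Real.sin ξ.1 / 2) ^ 2 ≤ (5 / 2) ^ 2 :=
    sq_le_sq' (by linarith) (by linarith)
  set c := 1 - Real.cos ξ.1 with hc
  have hc0 : 0 ≤ c := by linarith
  have hc2 : c ≤ 2 := by linarith
  have e2 : 797 / 600 - 1219 / 1200 * c + 797 / 2400 * c ^ 2 ≤ 2 := by nlinarith
  have e3 : c ^ 2 ≤ 4 := by nlinarith
  have e4 : c ^ 2 * (797 / 600 - 1219 / 1200 * c + 797 / 2400 * c ^ 2) ≤ 4 * 2 :=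
    mul_le_mul e3 e2 (by linarith [symbol_quartic_lower_bound c]) (by norm_num)
  unfold defect
  rw [← hc]
  linarith

theorem remainderR_eq (ξ : ℝ × ℝ) :
    remainderR ξ = ((Real.log (1 - defect ξ) + symbolP ξ / 100 : ℝ) : ℂ) := by
  rw [remainderR, fourierHat_psi, ← Complex.ofReal_log (by linarith [defect_lt_one ξ])]
  push_cast
  ring

/-! ### Failure of `R = o(P)` -/

/-- Along the curve `(-t², t)` the symbol is `t ^ 8`, whereas `1 - ψ̂` is at least a multiple of
`t ^ 6`; hence `R` is of order `t ^ 6` there and is not `o(P)`. -/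
theorem remainderR_not_isLittleO : ¬ (remainderR =o[𝓝 (0 : ℝ × ℝ)] symbolP) := by
  intro h
  have hγ : Tendsto (fun t : ℝ => ((-t ^ 2, t) : ℝ × ℝ)) (𝓝[>] 0) (𝓝 0) := by
    have : Continuous (fun t : ℝ => ((-t ^ 2, t) : ℝ × ℝ)) := by fun_prop
    have := this.tendsto 0
    simp only [ne_eq, OfNat.ofNat_ne_zero, not_false_eq_true, zero_pow, neg_zero] at this
    exact this.mono_left nhdsWithin_le_nhds
  have h1 := hγ.eventually (h.def (c := 1 / 100) (by norm_num))
  have h2 : ∀ᶠ t : ℝ in 𝓝[>] 0, t < 1 / 100 :=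
    nhdsWithin_le_nhds (eventually_lt_nhds (by norm_num))
  obtain ⟨t, h1, h2, h3⟩ := (h1.and (h2.and self_mem_nhdsWithin)).exists
  rw [remainderR_eq, Complex.norm_real, Real.norm_eq_abs, Real.norm_eq_abs] at h1
  have hP : symbolP (-t ^ 2, t) = t ^ 8 := by simp only [symbolP]; ring
  rw [hP, abs_of_nonneg (by positivity : 0 ≤ t ^ 8)] at h1
  have hs : t / 2 ≤ Real.sin t := by
    have := Real.sin_gt_sub_cube h3
    nlinarith [mul_pos h3 h3]
  have hs6 : (t / 2) ^ 6 ≤ Real.sin t ^ 6 := by gcongr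
  have hd := sin_pow_six_le_defect (-t ^ 2, t)
  -- `h1` bounds `|R|` by `t ^ 8 / 100`, while `R ≤ t ^ 8 / 100 - (t / 2) ^ 6 / 600`
  have hlog := Real.log_le_sub_one_of_pos (sub_pos.2 (defect_lt_one (-t ^ 2, t)))
  have := neg_abs_le (Real.log (1 - defect (-t ^ 2, t)) + t ^ 8 / 100)
  have h6 : 0 < t ^ 6 := by positivity
  have h8 : t ^ 8 ≤ t ^ 6 * (1 / 10000) := by
    calc t ^ 8 = t ^ 6 * t ^ 2 := by ring
      _ ≤ t ^ 6 * (1 / 10000) := by gcongr; nlinarith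
  nlinarith

/-! ### Taylor expansion of the logarithm -/

theorem isBigO_norm_pow_of_le {f : ℝ × ℝ → ℝ} {m n : ℕ} (h : f =O[𝓝 0] fun ξ => ‖ξ‖ ^ n)
    (hmn : m ≤ n) : f =O[𝓝 0] fun ξ => ‖ξ‖ ^ m := by
  refine h.trans (IsBigO.of_bound 1 ?_)
  filter_upwards [Metric.ball_mem_nhds (0 : ℝ × ℝ) one_pos] with ξ hξ
  rw [mem_ball_zero_iff] at hξ
  simpa using pow_le_pow_of_le_one (norm_nonneg ξ) hξ.le hmn

theorem isBigO_norm_pow_mul {f g : ℝ × ℝ → ℝ} {m n : ℕ} (hf : f =O[𝓝 0] fun ξ => ‖ξ‖ ^ m)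
    (hg : g =O[𝓝 0] fun ξ => ‖ξ‖ ^ n) : (fun ξ => f ξ * g ξ) =O[𝓝 0] fun ξ => ‖ξ‖ ^ (m + n) := by
  simpa only [pow_add] using hf.mul hg

theorem isBigO_norm_pow_pow {f : ℝ × ℝ → ℝ} (hf : f =O[𝓝 0] fun ξ => ‖ξ‖ ^ 1) (n : ℕ) :
    (fun ξ => f ξ ^ n) =O[𝓝 0] fun ξ => ‖ξ‖ ^ n := by
  simpa using hf.pow n

theorem isBigO_fst : (fun ξ : ℝ × ℝ => ξ.1) =O[𝓝 0] fun ξ => ‖ξ‖ ^ 1 :=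
  IsBigO.of_bound 1 (Eventually.of_forall fun ξ => by simpa using norm_fst_le ξ)

theorem isBigO_snd : (fun ξ : ℝ × ℝ => ξ.2) =O[𝓝 0] fun ξ => ‖ξ‖ ^ 1 :=
  IsBigO.of_bound 1 (Eventually.of_forall fun ξ => by simpa using norm_snd_le ξ)

theorem isBigO_sin_comp {f : ℝ × ℝ → ℝ} (hf : f =O[𝓝 0] fun ξ => ‖ξ‖ ^ 1) :
    (fun ξ => Real.sin (f ξ) - (f ξ - f ξ ^ 3 / 6)) =O[𝓝 0] fun ξ => ‖ξ‖ ^ 5 := by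
  have h0 : Tendsto f (𝓝 0) (𝓝 0) := hf.trans_tendsto (by
    have : Tendsto (fun ξ : ℝ × ℝ => ‖ξ‖ ^ 1) (𝓝 0) (𝓝 (‖(0 : ℝ × ℝ)‖ ^ 1)) :=
      Continuous.tendsto (by fun_prop) 0
    simpa using this)
  have h5 : (fun ξ => f ξ ^ 5) =O[𝓝 0] fun ξ => ‖ξ‖ ^ 5 := by simpa using hf.pow 5
  refine IsBigO.trans (IsBigO.of_bound 1 ?_) h5
  filter_upwards [h0.eventually (Metric.ball_mem_nhds 0 one_pos)] with ξ hξ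
  have hξ : |f ξ| ≤ 1 := by simpa using hξ.le
  have := Real.sin_bound hξ
  simp only [Real.norm_eq_abs, abs_pow]
  have h : 0 ≤ |f ξ| ^ 5 := by positivity
  linarith

/-- Through `1 - cos x = 2 sin² (x / 2)`, the fifth-order error of the sine carries over. -/
theorem isBigO_one_sub_cos_comp {f : ℝ × ℝ → ℝ} (hf : f =O[𝓝 0] fun ξ => ‖ξ‖ ^ 1) :
    (fun ξ => 1 - Real.cos (f ξ) - (f ξ ^ 2 / 2 - f ξ ^ 4 / 24)) =O[𝓝 0] fun ξ => ‖ξ‖ ^ 5 := by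
  have hf2 : (fun ξ => f ξ / 2) =O[𝓝 0] fun ξ => ‖ξ‖ ^ 1 := by
    simpa [div_eq_inv_mul] using hf.const_mul_left (2⁻¹ : ℝ)
  have hs := isBigO_sin_comp hf2
  have h3 : (fun ξ => f ξ ^ 3) =O[𝓝 0] fun ξ => ‖ξ‖ ^ 3 := by simpa using hf.pow 3
  have h6 : (fun ξ => f ξ ^ 6) =O[𝓝 0] fun ξ => ‖ξ‖ ^ 6 := by simpa using hf.pow 6
  have hsum : (fun ξ => Real.sin (f ξ / 2) + (f ξ / 2 - (f ξ / 2) ^ 3 / 6)) =O[𝓝 0]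
      fun ξ => ‖ξ‖ ^ 1 := by
    have := ((isBigO_norm_pow_of_le hs (m := 1) (by norm_num)).add (hf2.const_mul_left 2)).sub
      ((isBigO_norm_pow_of_le h3 (m := 1) (by norm_num)).const_mul_left (1 / 24))
    exact this.congr_left fun ξ => by ring
  have := (((isBigO_norm_pow_of_le (isBigO_norm_pow_mul hs hsum) (m := 5)
    (by norm_num)).const_mul_left 2).add
    ((isBigO_norm_pow_of_le h6 (m := 5) (by norm_num)).const_mul_left (1 / 1152)))
  refine this.congr_left fun ξ => ?_
  have hc : Real.cos (f ξ) = 1 - 2 * Real.sin (f ξ / 2) ^ 2 := by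
    rw [← Real.cos_sq_add_sin_sq (f ξ / 2)]
    have := Real.cos_two_mul' (f ξ / 2)
    rw [show 2 * (f ξ / 2) = f ξ by ring] at this
    linarith
  rw [hc]
  ring

/-- The fourth-order Taylor polynomial of `1 - ψ̂` at the origin. Writing `sin² η` as
`1 - cos² η` leaves `sin η * (1 - cos ζ)` as the only term that needs an expansion of `sin η`. -/
theorem defect_expansion :
    (fun ξ : ℝ × ℝ => defect ξ - (ξ.1 ^ 2 / 4 + ξ.1 * ξ.2 ^ 2 / 2 + ξ.2 ^ 4 / 4
      + 199 / 800 * ξ.1 ^ 4) / 25) =O[𝓝 0] fun ξ => ‖ξ‖ ^ 5 := by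
  have hc := isBigO_one_sub_cos_comp isBigO_fst
  have hs := isBigO_one_sub_cos_comp isBigO_snd
  have hsin := isBigO_sin_comp isBigO_fst
  -- the same functions with only their leading terms removed, then with nothing removed
  have hc2 : (fun ξ : ℝ × ℝ => 1 - Real.cos ξ.1 - ξ.1 ^ 2 / 2) =O[𝓝 0] fun ξ => ‖ξ‖ ^ 4 :=
    ((isBigO_norm_pow_of_le hc (by norm_num)).sub
      ((isBigO_norm_pow_pow isBigO_fst 4).const_mul_left (1 / 24))).congr_left fun ξ => by ring
  have hs2 : (fun ξ : ℝ × ℝ => 1 - Real.cos ξ.2 - ξ.2 ^ 2 / 2) =O[𝓝 0] fun ξ => ‖ξ‖ ^ 4 :=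
    ((isBigO_norm_pow_of_le hs (by norm_num)).sub
      ((isBigO_norm_pow_pow isBigO_snd 4).const_mul_left (1 / 24))).congr_left fun ξ => by ring
  have hc0 : (fun ξ : ℝ × ℝ => 1 - Real.cos ξ.1) =O[𝓝 0] fun ξ => ‖ξ‖ ^ 2 :=
    ((isBigO_norm_pow_of_le hc2 (by norm_num)).add
      ((isBigO_norm_pow_pow isBigO_fst 2).const_mul_left (1 / 2))).congr_left fun ξ => by ring
  have hs0 : (fun ξ : ℝ × ℝ => 1 - Real.cos ξ.2) =O[𝓝 0] fun ξ => ‖ξ‖ ^ 2 :=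
    ((isBigO_norm_pow_of_le hs2 (by norm_num)).add
      ((isBigO_norm_pow_pow isBigO_snd 2).const_mul_left (1 / 2))).congr_left fun ξ => by ring
  have hsin3 : (fun ξ : ℝ × ℝ => Real.sin ξ.1 - ξ.1) =O[𝓝 0] fun ξ => ‖ξ‖ ^ 3 :=
    ((isBigO_norm_pow_of_le hsin (by norm_num)).sub
      ((isBigO_norm_pow_pow isBigO_fst 3).const_mul_left (1 / 6))).congr_left fun ξ => by ring
  have hsinζ : (fun ξ : ℝ × ℝ => Real.sin ξ.2) =O[𝓝 0] fun ξ => ‖ξ‖ ^ 1 :=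
    IsBigO.trans (IsBigO.of_bound 1 (Eventually.of_forall fun ξ => by
      simpa using Real.abs_sin_le_abs)) isBigO_snd
  -- each summand is a product `(g - g₀) * h` or a power of total order at least five; a difference
  -- of squares `g ^ 2 - g₀ ^ 2` enters as `(g - g₀) * (g + g₀)`
  have t1 := isBigO_norm_pow_of_le (m := 5) (isBigO_norm_pow_mul hc2
    (hc0.add ((isBigO_norm_pow_pow isBigO_fst 2).const_mul_left (1 / 2)))) (by norm_num)
  have t2 := isBigO_norm_pow_of_le (m := 5) (isBigO_norm_pow_mul hs2
    (hs0.add ((isBigO_norm_pow_pow isBigO_snd 2).const_mul_left (1 / 2)))) (by norm_num)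
  have t3 := isBigO_norm_pow_of_le (m := 5) (isBigO_norm_pow_mul hs0 hsin3) (by norm_num)
  have t4 := isBigO_norm_pow_of_le (m := 5) (isBigO_norm_pow_mul hs2 isBigO_fst) (by norm_num)
  have t5 := isBigO_norm_pow_of_le (m := 5) (isBigO_norm_pow_mul (isBigO_norm_pow_mul hc0 hc0) hc0)
    (by norm_num)
  have t6 := isBigO_norm_pow_of_le (m := 5) (isBigO_norm_pow_mul (isBigO_norm_pow_mul hc0 hc0)
    (isBigO_norm_pow_mul hc0 hc0)) (by norm_num)
  have t7 := isBigO_norm_pow_of_le (m := 5) (isBigO_norm_pow_pow hsinζ 6) (by norm_num)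
  have := ((((((((hc.const_mul_left (1 / 2)).add (t1.const_mul_left (647 / 600))).add t2).add t3).add
    t4).sub (t5.const_mul_left (1219 / 1200))).add (t6.const_mul_left (797 / 2400))).add
    (t7.const_mul_left (1 / 24))).const_mul_left (1 / 25)
  refine this.congr_left fun ξ => ?_
  have hsq := Real.sin_sq ξ.1
  unfold defect
  linear_combination (-1 / 100 : ℝ) * hsq

/-- `log (1 - u) = -u - u² / 2 + O(u³)` for `u = 1 - ψ̂ = O(|ξ|²)`, and the quartic coefficient
`-199 / 20000` of `-u` and `-1 / 20000` of `-u² / 2` add up to the `-1 / 100` required by `P`. -/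
theorem remainderR_isBigO : remainderR =O[𝓝 (0 : ℝ × ℝ)] fun ξ => ‖ξ‖ ^ 5 := by
  have hd := defect_expansion
  have hd3 : (fun ξ : ℝ × ℝ => defect ξ - ξ.1 ^ 2 / 100) =O[𝓝 0] fun ξ => ‖ξ‖ ^ 3 :=
    ((((isBigO_norm_pow_of_le hd (by norm_num)).add
      ((isBigO_norm_pow_mul isBigO_fst (isBigO_norm_pow_pow isBigO_snd 2)).const_mul_left
        (1 / 50))).add
      ((isBigO_norm_pow_of_le (isBigO_norm_pow_pow isBigO_snd 4) (by norm_num)).const_mul_left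
        (1 / 100))).add
      ((isBigO_norm_pow_of_le (isBigO_norm_pow_pow isBigO_fst 4) (by norm_num)).const_mul_left
        (199 / 20000))).congr_left fun ξ => by ring
  have hd2 : defect =O[𝓝 0] fun ξ => ‖ξ‖ ^ 2 :=
    ((isBigO_norm_pow_of_le hd3 (by norm_num)).add
      ((isBigO_norm_pow_pow isBigO_fst 2).const_mul_left (1 / 100))).congr_left fun ξ => by ring
  have h0 : Tendsto defect (𝓝 0) (𝓝 0) := hd2.trans_tendsto (by
    have : Tendsto (fun ξ : ℝ × ℝ => ‖ξ‖ ^ 2) (𝓝 0) (𝓝 (‖(0 : ℝ × ℝ)‖ ^ 2)) :=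
      Continuous.tendsto (by fun_prop) 0
    simpa using this)
  have hlog : (fun ξ => defect ξ + defect ξ ^ 2 / 2 + Real.log (1 - defect ξ)) =O[𝓝 0]
      fun ξ => ‖ξ‖ ^ 5 := by
    have h6 : (fun ξ => defect ξ ^ 3) =O[𝓝 0] fun ξ => ‖ξ‖ ^ 6 := by
      simpa [← pow_mul] using hd2.pow 3
    refine IsBigO.trans (IsBigO.of_bound 2 ?_) (isBigO_norm_pow_of_le h6 (by norm_num))
    filter_upwards [h0.eventually (Metric.ball_mem_nhds 0 (by norm_num : (0 : ℝ) < 1 / 2))] with ξ hξ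
    have hξ : |defect ξ| < 1 / 2 := by simpa using hξ
    have := Real.abs_log_sub_add_sum_range_le (x := defect ξ) (by linarith) 2
    simp only [Finset.sum_range_succ, Finset.sum_range_zero] at this
    norm_num at this
    rw [Real.norm_eq_abs, Real.norm_eq_abs, abs_pow]
    refine this.trans ?_
    rw [div_le_iff₀ (by linarith)]
    nlinarith [pow_nonneg (abs_nonneg (defect ξ)) 3]
  have hsq := isBigO_norm_pow_mul hd3 (hd2.add
    ((isBigO_norm_pow_pow isBigO_fst 2).const_mul_left (1 / 100)))
  have h := (hlog.sub hd).sub (hsq.const_mul_left (1 / 2))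
  have hreal : (fun ξ => Real.log (1 - defect ξ) + symbolP ξ / 100) =O[𝓝 0]
      fun ξ => ‖ξ‖ ^ 5 := h.congr_left fun ξ => by unfold symbolP; ring
  refine IsBigO.of_norm_left (hreal.norm_left.congr_left fun ξ => ?_)
  rw [remainderR_eq, Complex.norm_real]

section

open MeasureTheory

/-! ### Fourier inversion for convolution powers -/

theorem integral_exp_int_mul (a : ℤ) :
    ∫ t in Set.Icc (-Real.pi) Real.pi, Complex.exp (-(Complex.I * ((a * t : ℝ) : ℂ))) =
      if a = 0 then 2 * (Real.pi : ℂ) else 0 := by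
  rw [integral_Icc_eq_integral_Ioc, ← intervalIntegral.integral_of_le (by linarith [Real.pi_pos])]
  split_ifs with ha
  · simp [ha]
    ring
  · have hc : -(Complex.I * a) ≠ 0 := by simpa using ha
    have h := integral_exp_mul_complex (a := -Real.pi) (b := Real.pi) hc
    have he : Complex.exp (-(Complex.I * a) * (Real.pi : ℝ)) =
        Complex.exp (-(Complex.I * a) * ((-Real.pi : ℝ) : ℂ)) := by
      rw [Complex.exp_eq_exp_iff_exists_int]
      -- the exponents at `±π` differ by `-2πia`
      exact ⟨-a, by push_cast; ring⟩
    rw [he, sub_self, zero_div] at h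
    rw [← h]
    congr 1
    ext t
    push_cast
    ring_nf

theorem fourierHat_eq_sum {f : ℤ × ℤ → ℂ} (hf : (Function.support f).Finite) (ξ : ℝ × ℝ) :
    fourierHat f ξ = ∑ x ∈ hf.toFinset,
      f x * Complex.exp (Complex.I * ((x.1 * ξ.1 + x.2 * ξ.2 : ℝ) : ℂ)) :=
  tsum_eq_sum fun x hx => by
    have : f x = 0 := by simpa using hx
    rw [this, zero_mul]

theorem continuous_fourierHat {f : ℤ × ℤ → ℂ} (hf : (Function.support f).Finite) :
    Continuous (fourierHat f) := by
  rw [funext (fourierHat_eq_sum hf)]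
  fun_prop

theorem convPow_succ (f : ℤ × ℤ → ℂ) (n : ℕ) :
    convPow f (n + 1) = convolution2 (convPow f n) f := by
  cases n with
  | succ n => rfl
  | zero =>
    ext x
    change f x = ∑' y, (Pi.single 0 1 : ℤ × ℤ → ℂ) (x - y) * f y
    rw [tsum_eq_single x fun y hy => ?_]
    · simp
    · rw [Pi.single_eq_of_ne (sub_ne_zero.2 hy.symm), zero_mul]

/-- The period square `[-π, π]²` of Fourier transforms of functions on `ℤ²`. -/
def frequencySquare : Set (ℝ × ℝ) :=
  Set.Icc (-Real.pi) Real.pi ×ˢ Set.Icc (-Real.pi) Real.pi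

theorem isCompact_frequencySquare : IsCompact frequencySquare :=
  isCompact_Icc.prod isCompact_Icc

/-- Fourier inversion for convolution powers. By induction on `n`: orthogonality of characters gives
the unit mass for `n = 0`, and convolving with `f` multiplies the integrand by `f̂`. -/
theorem convPow_eq_integral {f : ℤ × ℤ → ℂ} (hf : (Function.support f).Finite) (n : ℕ)
    (x : ℤ × ℤ) : convPow f n x = (1 / (2 * Real.pi) ^ 2 : ℂ) * ∫ ξ in frequencySquare,
      fourierHat f ξ ^ n * Complex.exp (-(Complex.I * ((x.1 * ξ.1 + x.2 * ξ.2 : ℝ) : ℂ))) := by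
  induction n generalizing x with
  | zero =>
    have hsplit : ∀ ξ : ℝ × ℝ,
        fourierHat f ξ ^ 0 * Complex.exp (-(Complex.I * ((x.1 * ξ.1 + x.2 * ξ.2 : ℝ) : ℂ))) =
        Complex.exp (-(Complex.I * ((x.1 * ξ.1 : ℝ) : ℂ))) *
          Complex.exp (-(Complex.I * ((x.2 * ξ.2 : ℝ) : ℂ))) := fun ξ => by
      rw [← Complex.exp_add, pow_zero, one_mul]
      push_cast
      ring_nf
    simp_rw [hsplit]
    rw [frequencySquare, Measure.volume_eq_prod, setIntegral_prod_mul
      (fun t : ℝ => Complex.exp (-(Complex.I * ((x.1 * t : ℝ) : ℂ))))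
      (fun t : ℝ => Complex.exp (-(Complex.I * ((x.2 * t : ℝ) : ℂ)))),
      integral_exp_int_mul, integral_exp_int_mul]
    have hpi : (Real.pi : ℂ) ≠ 0 := by exact_mod_cast Real.pi_ne_zero
    by_cases h1 : x.1 = 0
    · by_cases h2 : x.2 = 0
      · have hx : x = 0 := Prod.ext h1 h2
        simp [hx, convPow]
        field_simp
      · have hx : x ≠ 0 := fun h => h2 (by simp [h])
        simp [convPow, hx, h2]
    · have hx : x ≠ 0 := fun h => h1 (by simp [h])
      simp [convPow, hx, h1]
  | succ n ih =>
    rw [convPow_succ, convolution2, tsum_eq_sum (s := hf.toFinset) fun y hy => by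
      have : f y = 0 := by simpa using hy
      rw [this, mul_zero]]
    simp_rw [ih, mul_assoc, mul_comm _ (f _), mul_left_comm _ (f _)]
    simp_rw [← integral_const_mul]
    rw [← integral_finsetSum]
    · congr 1
      ext ξ
      have h := fourierHat_eq_sum hf ξ
      rw [pow_succ (fourierHat f ξ)]
      generalize fourierHat f ξ ^ n = A
      rw [h, Finset.mul_sum, Finset.sum_mul, Finset.mul_sum]
      refine Finset.sum_congr rfl fun y _ => ?_
      have he : Complex.exp (-(Complex.I * (((x - y).1 * ξ.1 + (x - y).2 * ξ.2 : ℝ) : ℂ))) =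
          Complex.exp (Complex.I * ((y.1 * ξ.1 + y.2 * ξ.2 : ℝ) : ℂ)) *
            Complex.exp (-(Complex.I * ((x.1 * ξ.1 + x.2 * ξ.2 : ℝ) : ℂ))) := by
        rw [← Complex.exp_add]
        congr 1
        simp only [Prod.fst_sub, Prod.snd_sub]
        push_cast
        ring
      rw [he]
      ring
    · intro y _
      have := continuous_fourierHat hf
      exact ContinuousOn.integrableOn_compact isCompact_frequencySquare (by fun_prop)

/-! ### Decay of the integrals -/

open Real

/-- Uniformly in `s`, by the substitution `u = sin η`, whose derivative is at least `1 / 2` on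
`[-1, 1]`. -/
theorem integral_exp_neg_mul_sin_le (a s : ℝ) (ha : 0 < a) :
    ∫ η in Set.Icc (-1 : ℝ) 1, exp (-a * (s + sin η / 2) ^ 2) ≤ 4 * √(π / a) := by
  have hcos : ∀ η ∈ Set.Icc (-1 : ℝ) 1, 1 / 2 ≤ cos η := fun η hη => by
    have := Real.one_sub_sq_div_two_le_cos (x := η)
    nlinarith [hη.1, hη.2]
  have hint : Integrable fun u : ℝ => exp (-a * (s + u / 2) ^ 2) := by
    have := (integrable_exp_neg_mul_sq (b := a / 4) (by positivity)).comp_add_right (2 * s)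
    refine this.congr (Eventually.of_forall fun u => ?_)
    simp only
    congr 1
    ring
  calc ∫ η in Set.Icc (-1 : ℝ) 1, exp (-a * (s + sin η / 2) ^ 2)
      ≤ ∫ η in Set.Icc (-1 : ℝ) 1, 2 * (exp (-a * (s + sin η / 2) ^ 2) * cos η) := by
        refine setIntegral_mono_on (Continuous.integrableOn_Icc (by fun_prop))
          (Continuous.integrableOn_Icc (by fun_prop)) measurableSet_Icc fun η hη => ?_
        nlinarith [hcos η hη, exp_pos (-a * (s + sin η / 2) ^ 2)]
    _ = 2 * ∫ u in (sin (-1))..(sin 1), exp (-a * (s + u / 2) ^ 2) := by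
        rw [integral_const_mul, integral_Icc_eq_integral_Ioc,
          ← intervalIntegral.integral_of_le (by norm_num)]
        congr 1
        exact intervalIntegral.integral_comp_mul_deriv (f := sin) (f' := cos)
          (g := fun u => exp (-a * (s + u / 2) ^ 2))
          (fun x _ => hasDerivAt_sin x) continuous_cos.continuousOn (by fun_prop)
    _ ≤ 2 * ∫ u : ℝ, exp (-a * (s + u / 2) ^ 2) := by
        gcongr
        rw [intervalIntegral.integral_of_le (by
          rw [sin_neg]
          linarith [sin_nonneg_of_nonneg_of_le_pi (x := 1) (by norm_num)
            (by linarith [pi_gt_three])])]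
        exact setIntegral_le_integral hint (Eventually.of_forall fun u => (exp_pos _).le)
    _ = 4 * √(π / a) := by
        have h1 : (fun u : ℝ => exp (-a * (s + u / 2) ^ 2)) =
            fun u => (fun v => exp (-(a / 4) * v ^ 2)) (u + 2 * s) := by
          ext u; simp only; congr 1; ring
        rw [h1, integral_add_right_eq_self (fun v => exp (-(a / 4) * v ^ 2)), integral_gaussian,
          show π / (a / 4) = 2 ^ 2 * (π / a) by field_simp; norm_num, sqrt_mul (by norm_num),
          sqrt_sq (by norm_num)]
        ring

/-- Jordan's inequality `sin ζ ≥ 2 ζ / π` reduces the integral to that of `exp (-c ζ ^ 6)`. -/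
theorem integral_exp_neg_mul_sin_pow_six_le {b : ℝ} (hb : 0 < b) :
    ∫ ζ in Set.Icc (-(π / 2)) (π / 2), exp (-b * sin ζ ^ 6) ≤
      π * Gamma (7 / 6) * b ^ (-(1 / 6) : ℝ) := by
  have hp := pi_pos
  have hc : 0 < b * (2 / π) ^ 6 := by positivity
  have hI : IntegrableOn (fun ζ : ℝ => exp (-(b * (2 / π) ^ 6) * ζ ^ (6 : ℝ))) (Set.Ioi 0) := by
    have := integrableOn_rpow_mul_exp_neg_mul_rpow (s := 0) (p := 6) (by norm_num) (by norm_num) hc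
    simpa using this
  calc ∫ ζ in Set.Icc (-(π / 2)) (π / 2), exp (-b * sin ζ ^ 6)
      = ∫ ζ in (-(π / 2))..(π / 2), exp (-b * sin ζ ^ 6) := by
        rw [integral_Icc_eq_integral_Ioc, ← intervalIntegral.integral_of_le (by linarith)]
    _ = 2 * ∫ ζ in (0 : ℝ)..(π / 2), exp (-b * sin ζ ^ 6) := by
        have hci : ∀ x y, IntervalIntegrable (fun ζ => exp (-b * sin ζ ^ 6)) volume x y :=
          fun x y => Continuous.intervalIntegrable (by fun_prop) x y
        rw [← intervalIntegral.integral_add_adjacent_intervals (hci (-(π / 2)) 0) (hci 0 _)]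
        have := intervalIntegral.integral_comp_neg (a := 0) (b := π / 2)
          (fun ζ => exp (-b * sin ζ ^ 6))
        simp only [sin_neg, neg_zero, Even.neg_pow (by decide : Even 6)] at this
        rw [← this]
        ring
    _ ≤ 2 * ∫ ζ in Set.Ioi (0 : ℝ), exp (-(b * (2 / π) ^ 6) * ζ ^ (6 : ℝ)) := by
        gcongr
        rw [intervalIntegral.integral_of_le (by linarith)]
        refine le_trans (setIntegral_mono_on
          (g := fun ζ : ℝ => exp (-(b * (2 / π) ^ 6) * ζ ^ (6 : ℝ)))
          (Continuous.integrableOn_Ioc (by fun_prop)) (hI.mono_set fun ζ h => h.1)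
          measurableSet_Ioc fun ζ hζ => ?_) (setIntegral_mono_set hI
            (Eventually.of_forall fun ζ => (exp_pos _).le)
            (Eventually.of_forall fun ζ h => h.1))
        have h1 := mul_le_sin hζ.1.le hζ.2
        have h2 : (2 / π * ζ) ^ 6 ≤ sin ζ ^ 6 :=
          pow_le_pow_left₀ (mul_nonneg (by positivity) hζ.1.le) h1 6
        rw [exp_le_exp, show ζ ^ (6 : ℝ) = ζ ^ 6 by exact_mod_cast rpow_natCast ζ 6]
        rw [mul_pow] at h2
        nlinarith
    _ = π * Gamma (7 / 6) * b ^ (-(1 / 6) : ℝ) := by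
        -- the scaling factor `((2 / π) ^ 6) ^ (-1 / 6) = π / 2` cancels the factor `2`
        rw [integral_exp_neg_mul_rpow (by norm_num) hc, mul_rpow hb.le (by positivity),
          ← rpow_natCast (2 / π) 6, ← rpow_mul (by positivity)]
        norm_num
        rw [rpow_neg_one]
        field_simp

/-- Off the box `[-1, 1] × [-π/2, π/2]` the function `1 - ψ̂` is at least `1 / 500`, since there
`cos η ≤ 3 / 5` or `cos ζ ≤ 0`; on the box two of its nonnegative summands are kept. -/
theorem exp_neg_mul_defect_le {a : ℝ} (ha : 0 ≤ a) {ξ : ℝ × ℝ}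
    (hξ : ξ ∈ frequencySquare) :
    exp (-(a * defect ξ)) ≤ exp (-(a / 500)) +
      (Set.Icc (-1 : ℝ) 1 ×ˢ Set.Icc (-(π / 2)) (π / 2)).indicator
        (fun ξ => exp (-(a / 25) * (1 - cos ξ.2 + sin ξ.1 / 2) ^ 2) *
          exp (-(a / 600) * sin ξ.2 ^ 6)) ξ := by
  obtain ⟨η, ζ⟩ := ξ
  obtain ⟨⟨hη1, hη2⟩, hζ1, hζ2⟩ := hξ
  simp only at hη1 hη2 hζ1 hζ2
  have hγ := symbol_quartic_lower_bound (1 - cos η)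
  have h6 : 0 ≤ sin ζ ^ 6 := by positivity
  have hc2 : (1 - cos η) ^ 2 * (1 / 2) ≤ (1 - cos η) ^ 2 * (797 / 600 - 1219 / 1200 * (1 - cos η)
      + 797 / 2400 * (1 - cos η) ^ 2) := mul_le_mul_of_nonneg_left hγ (sq_nonneg _)
  have far : 1 / 500 ≤ defect (η, ζ) → exp (-(a * defect (η, ζ))) ≤ exp (-(a / 500)) := fun h => by
    rw [exp_le_exp]
    nlinarith
  have hind : 0 ≤ (Set.Icc (-1 : ℝ) 1 ×ˢ Set.Icc (-(π / 2)) (π / 2)).indicator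
        (fun ξ : ℝ × ℝ => exp (-(a / 25) * (1 - cos ξ.2 + sin ξ.1 / 2) ^ 2) *
          exp (-(a / 600) * sin ξ.2 ^ 6)) (η, ζ) :=
    Set.indicator_nonneg (fun ξ _ => by positivity) _
  by_cases hη : η ∈ Set.Icc (-1 : ℝ) 1
  · by_cases hζ : ζ ∈ Set.Icc (-(π / 2)) (π / 2)
    · rw [Set.indicator_of_mem (Set.mk_mem_prod hη hζ), ← exp_add]
      refine le_add_of_nonneg_of_le (exp_pos _).le ?_
      rw [exp_le_exp]
      have : (1 - cos ζ + sin η / 2) ^ 2 / 25 + sin ζ ^ 6 / 600 ≤ defect (η, ζ) := by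
        unfold defect
        nlinarith [sq_nonneg (1 - cos η)]
      simp only
      nlinarith
    · have hcos : cos ζ ≤ 0 := by
        rw [← cos_abs]
        refine cos_nonpos_of_pi_div_two_le_of_le ?_ ?_
        · by_contra h
          exact hζ (abs_le.1 (not_le.1 h).le)
        · have : |ζ| ≤ π := abs_le.2 ⟨hζ1, hζ2⟩
          linarith [pi_pos]
      refine le_add_of_le_of_nonneg (far ?_) hind
      unfold defect
      have := neg_one_le_sin η
      nlinarith [sq_nonneg (1 - cos η)]
  · have hcos : cos η ≤ 3 / 5 := by
      have h1 : 1 ≤ |η| := by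
        by_contra h
        exact hη (abs_le.1 (not_le.1 h).le)
      rw [← cos_abs]
      refine (cos_le_cos_of_nonneg_of_le_pi (by norm_num) (abs_le.2 ⟨hη1, hη2⟩) h1).trans ?_
      have := cos_one_le
      linarith
    refine le_add_of_le_of_nonneg (far ?_) hind
    unfold defect
    nlinarith [sq_nonneg (1 - cos ζ + sin η / 2)]

/-- The part of the integral near the curve `1 - cos ζ + sin η / 2 = 0`, integrated first in `η`:
it is of order `a ^ (-1 / 2) * a ^ (-1 / 6)`. -/
theorem integral_ridge_le {a : ℝ} (ha : 0 < a) :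
    ∫ ξ in Set.Icc (-1 : ℝ) 1 ×ˢ Set.Icc (-(π / 2)) (π / 2),
      exp (-(a / 25) * (1 - cos ξ.2 + sin ξ.1 / 2) ^ 2) * exp (-(a / 600) * sin ξ.2 ^ 6) ≤
    4 * √(π / (a / 25)) * (π * Gamma (7 / 6) * (a / 600) ^ (-(1 / 6) : ℝ)) := by
  have hint : IntegrableOn (fun ξ : ℝ × ℝ => exp (-(a / 25) * (1 - cos ξ.2 + sin ξ.1 / 2) ^ 2) *
      exp (-(a / 600) * sin ξ.2 ^ 6)) (Set.Icc (-1 : ℝ) 1 ×ˢ Set.Icc (-(π / 2)) (π / 2)) :=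
    ContinuousOn.integrableOn_compact (isCompact_Icc.prod isCompact_Icc) (by fun_prop)
  rw [IntegrableOn, Measure.volume_eq_prod, ← Measure.prod_restrict] at hint
  rw [Measure.volume_eq_prod, ← Measure.prod_restrict, integral_prod_symm _ hint]
  calc _ ≤ ∫ ζ in Set.Icc (-(π / 2)) (π / 2),
        4 * √(π / (a / 25)) * exp (-(a / 600) * sin ζ ^ 6) := by
        refine integral_mono hint.integral_prod_right
          (Continuous.integrableOn_Icc (by fun_prop)) fun ζ => ?_
        simp only
        rw [integral_mul_const]
        exact mul_le_mul_of_nonneg_right (integral_exp_neg_mul_sin_le _ _ (by positivity))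
          (exp_pos _).le
    _ ≤ _ := by
        rw [integral_const_mul]
        exact mul_le_mul_of_nonneg_left (integral_exp_neg_mul_sin_pow_six_le (by positivity))
          (by positivity)

theorem supNorm_convPow_psi_le {n : ℕ} (hn : n ≠ 0) :
    supNorm (convPow psi n) ≤ exp (-((n : ℝ) / 500)) +
      4 * √(π / (n / 25)) * (π * Gamma (7 / 6) * ((n : ℝ) / 600) ^ (-(1 / 6) : ℝ)) := by
  have hn' : (0 : ℝ) < n := by positivity
  refine ciSup_le fun x => ?_
  have hpi : 1 ≤ (2 * π) ^ 2 := by nlinarith [pi_gt_three]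
  set ridge : ℝ × ℝ → ℝ := fun ξ => exp (-((n : ℝ) / 25) * (1 - cos ξ.2 + sin ξ.1 / 2) ^ 2) *
    exp (-((n : ℝ) / 600) * sin ξ.2 ^ 6) with hridge
  set box : Set (ℝ × ℝ) := Set.Icc (-1 : ℝ) 1 ×ˢ Set.Icc (-(π / 2)) (π / 2) with hbox
  have hboxm : MeasurableSet box := measurableSet_Icc.prod measurableSet_Icc
  have hsub : box ⊆ frequencySquare :=
    Set.prod_mono (Set.Icc_subset_Icc (by linarith [pi_gt_three]) (by linarith [pi_gt_three]))
      (Set.Icc_subset_Icc (by linarith [pi_pos]) (by linarith [pi_pos]))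
  have hcr : IntegrableOn ridge frequencySquare :=
    ContinuousOn.integrableOn_compact isCompact_frequencySquare (by fun_prop)
  have hconst : Integrable (fun _ : ℝ × ℝ => exp (-((n : ℝ) / 500)))
      (volume.restrict frequencySquare) :=
    integrableOn_const isCompact_frequencySquare.measure_ne_top
  have hvol : volume.real frequencySquare = (2 * π) ^ 2 := by
    rw [frequencySquare, Measure.volume_eq_prod, measureReal_prod_prod,
      Real.volume_real_Icc_of_le (by linarith [pi_pos])]
    ring
  have hB : ∫ ξ in frequencySquare, ‖fourierHat psi ξ ^ n *
      Complex.exp (-(Complex.I * ((x.1 * ξ.1 + x.2 * ξ.2 : ℝ) : ℂ)))‖ ≤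
      (2 * π) ^ 2 * exp (-((n : ℝ) / 500)) + ∫ ξ in box, ridge ξ := by
    calc _ ≤ ∫ ξ in frequencySquare, (exp (-((n : ℝ) / 500)) + box.indicator ridge ξ) := by
          have := continuous_fourierHat psi_support_finite
          refine setIntegral_mono_on (ContinuousOn.integrableOn_compact
            isCompact_frequencySquare (by fun_prop)) (Integrable.add
              hconst
              (hcr.indicator hboxm))
            isCompact_frequencySquare.measurableSet fun ξ hξ => ?_
          refine le_trans ?_ (exp_neg_mul_defect_le hn'.le hξ)
          have h1 := defect_lt_one ξ
          rw [norm_mul, norm_pow, fourierHat_psi, Complex.norm_real, norm_eq_abs,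
            abs_of_pos (sub_pos.2 h1), ← mul_neg, ← Complex.ofReal_neg,
            Complex.norm_exp_I_mul_ofReal, mul_one, ← mul_neg, exp_nat_mul]
          exact pow_le_pow_left₀ (sub_pos.2 h1).le (one_sub_le_exp_neg _) n
      _ = _ := by
          rw [integral_add hconst
            (hcr.indicator hboxm), setIntegral_const, hvol, setIntegral_indicator hboxm,
            Set.inter_eq_right.2 hsub, smul_eq_mul]
  have hr0 : 0 ≤ ∫ ξ in box, ridge ξ := integral_nonneg fun ξ => by positivity
  rw [convPow_eq_integral psi_support_finite, norm_mul]
  have hnorm : ‖(1 / (2 * π) ^ 2 : ℂ)‖ = ((2 * π) ^ 2)⁻¹ := by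
    rw [one_div, norm_inv, norm_pow, norm_mul, Complex.norm_ofNat, Complex.norm_real,
      norm_of_nonneg pi_pos.le]
  rw [hnorm]
  calc _ ≤ ((2 * π) ^ 2)⁻¹ * ((2 * π) ^ 2 * exp (-((n : ℝ) / 500)) + ∫ ξ in box, ridge ξ) :=
        mul_le_mul_of_nonneg_left ((norm_integral_le_integral_norm _).trans hB) (by positivity)
    _ = exp (-((n : ℝ) / 500)) + ((2 * π) ^ 2)⁻¹ * ∫ ξ in box, ridge ξ := by
        rw [mul_add, inv_mul_cancel_left₀ (by positivity)]
    _ ≤ exp (-((n : ℝ) / 500)) + 1 * ∫ ξ in box, ridge ξ := by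
        gcongr
        exact inv_le_one_of_one_le₀ hpi
    _ ≤ _ := by
        rw [one_mul]
        gcongr
        exact integral_ridge_le hn'

theorem tendsto_rpow_mul_supNorm_convPow_psi :
    Tendsto (fun n : ℕ => (n : ℝ) ^ (5 / 8 : ℝ) * supNorm (convPow psi n)) atTop (𝓝 0) := by
  set C : ℝ := 4 * √(π * 25) * (π * Gamma (7 / 6) * (600⁻¹ : ℝ) ^ (-(1 / 6) : ℝ)) with hC
  have hg : Tendsto (fun n : ℕ => (n : ℝ) ^ (5 / 8 : ℝ) * exp (-(1 / 500) * (n : ℝ)) +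
      C * (n : ℝ) ^ (-(1 / 24) : ℝ)) atTop (𝓝 0) := by
    have h1 := (tendsto_rpow_mul_exp_neg_mul_atTop_nhds_zero (5 / 8) (1 / 500)
      (by norm_num)).comp tendsto_natCast_atTop_atTop
    have h2 := ((tendsto_rpow_neg_atTop (y := 1 / 24) (by norm_num)).comp
      tendsto_natCast_atTop_atTop).const_mul C
    simpa [Function.comp_def] using h1.add h2
  refine squeeze_zero' (Eventually.of_forall fun n => mul_nonneg (by positivity)
    (Real.iSup_nonneg fun x => norm_nonneg _)) ?_ hg
  filter_upwards [eventually_ne_atTop 0] with n hn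
  have hn' : (0 : ℝ) < n := by positivity
  refine (mul_le_mul_of_nonneg_left (supNorm_convPow_psi_le hn) (by positivity)).trans_eq ?_
  rw [mul_add, show -((n : ℝ) / 500) = -(1 / 500) * n by ring]
  congr 1
  rw [show π / ((n : ℝ) / 25) = π * 25 * (n : ℝ)⁻¹ by field_simp, sqrt_mul (by positivity),
    sqrt_inv, sqrt_eq_rpow (n : ℝ), ← rpow_neg hn'.le, div_eq_mul_inv (n : ℝ),
    mul_rpow hn'.le (by norm_num)]
  have hexp : (n : ℝ) ^ (-(1 / 24) : ℝ) =
      (n : ℝ) ^ (5 / 8 : ℝ) * (n : ℝ) ^ (-(1 / 2) : ℝ) * (n : ℝ) ^ (-(1 / 6) : ℝ) := by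
    rw [← rpow_add hn', ← rpow_add hn']
    norm_num
  rw [hexp, hC]
  ring

end

theorem proposition5p6 :
    -- `log ψ̂ = -P/100 + R` where `R` has only terms of order at least five at the origin
    (remainderR =O[𝓝 (0 : ℝ × ℝ)] fun ξ => ‖ξ‖ ^ 5) ∧
    -- the remainder `R` is not `o(P)` at the origin
    ¬ (remainderR =o[𝓝 (0 : ℝ × ℝ)] symbolP) ∧
    -- nevertheless the sup norms of the convolution powers decay faster than `n^(-5/8)`
    Tendsto (fun n : ℕ => (n : ℝ) ^ (5 / 8 : ℝ) * supNorm (convPow psi n)) atTop (𝓝 0) :=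
  ⟨remainderR_isBigO, remainderR_not_isLittleO, tendsto_rpow_mul_supNorm_convPow_psi⟩
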